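/- Let $p$ and $\ell$ be distinct odd primes, let $q$ be a power of $p$, and let $m\ge 1$, $n\ge 0$ be integers with $\gcd(\ell,q-1)=1$. Put $N=2\ell^mp^n$, let $\xi$ be a generator of $\mathbb F_q^*$, let $\eta$ be a primitive $\ell^m$-th root of unity in an extension field of $\mathbb F_{q^2}$, and let $f=\mathrm{ord}_\ell(q)$ be the multiplicative order of $q$ modulo $\ell$. For $t\in\mathbb Z/\ell^m$ let $C_t=\{tq^j: j\ge 0\}$ and $D_t=\{tq^{2j}: j\ge 0\}$ be the $q$- and the $q^2$-cyclotomic coset of $t$ modulo $\ell^m$. Let $\rho_0=0,\rho_1,\dots,\rho_e$ be such that $C_{\rho_0},\dots,C_{\rho_e}$ are all the $q$-cyclotomic cosets modulo $\ell^m$, each listed once. Let $M_t(X)$ be the minimal polynomial of $\eta^t$ over $\mathbb F_q$, and let $N_t(X)=\prod_{s\in D_t}(X-\eta^s)$. For a nonzero polynomial $h$ and a nonzero scalar $c$, let $\hat h(cX)$ denote the polynomial $h(cX)$ divided by its leading coefficient. Let $\lambda\in\mathbb F_q^*$. A $\lambda$-constacyclic code of length $N$ is a linear subspace of $\mathbb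 F_q^N$ that contains $(\lambda c_{N-1},c_0,\dots,c_{N-2})$ whenever it contains $(c_0,\dots,c_{N-1})$. For a monic divisor $g$ of $X^N-\lambda$ in $\mathbb F_q[X]$, let $\langle g\rangle$ be the set of words $(c_0,\dots,c_{N-1})$ such that the class of $\sum_i c_iX^i$ lies in the ideal generated by $g$ in $\mathbb F_q[X]/\langle X^N-\lambda\rangle$; $g$ is then the generator polynomial of this code. The following holds. **(A)** If $\lambda\in\langle\xi^2\rangle$, then there is $a\in\mathbb F_q^*$ with $a^{N}\lambda=1$, and for every such $a$ $$X^{N}-\lambda=\prod_{i=0}^{e}\hat M_{\rho_i}(aX)^{p^n}\hat M_{\rho_i}(-aX)^{p^n},$$ where the polynomials $\hat M_{\rho_i}(\pm aX)$ are irreducible over $\mathbb F_q$. The $\lambda$-constacyclic codes of length $N$ over $\mathbb F_q$ are exactly the codes $$C=\Big\langle\prod_{i=0}^{e}\hat M_{\rho_i}(aX)^{\varepsilon_i}\hat M_{\rho_i}(-aX)^{\epsilon_i}\Big\rangle,\qquad 0\le\varepsilon_i,\epsilon_i\le p^n,\quad 0\le i\le e,$$ and the exponents are uniquely determined by $C$.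 **(B)** If $\lambda\notin\langle\xi^2\rangle$, then there is $b\in\mathbb F_q^*$ with $b^{N}\lambda=\xi^{p^n}$, and there is $\alpha_1\in\mathbb F_{q^2}$ with $\alpha_1^2=\xi$. For every such $\alpha_1$ there is exactly one primitive $2(q-1)$-th root of unity $\beta_1\in\mathbb F_{q^2}$ with $\beta_1^{\ell^m}\alpha_1=1$, and it satisfies $\beta_1^q=-\beta_1$. For every such $b$, $\alpha_1$ and $\beta_1$: **(B1)** If $f$ is odd, then the polynomials $S_i(X)=\hat M_{\rho_i}(\beta_1X)\hat M_{\rho_i}(-\beta_1X)$, $0\le i\le e$, have coefficients in $\mathbb F_q$, the polynomials $\hat S_i(bX)$ are irreducible over $\mathbb F_q$, and $$X^{N}-\lambda=\prod_{i=0}^{e}\hat S_i(bX)^{p^n}.$$ The $\lambda$-constacyclic codes of length $N$ over $\mathbb F_q$ are exactly the codes $C=\big\langle\prod_{i=0}^{e}\hat S_i(bX)^{\varepsilon_i}\big\rangle$ with $0\le\varepsilon_i\le p^n$ for $0\le i\le e$, and the exponents are uniquely determined by $C$. **(B2)** If $f$ is even, then $P(X)=(X-\beta_1^{-1})(X+\beta_1^{-1})$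 and, for $1\le i\le e$, $Q_i(X)=\hat N_{\rho_i}(\beta_1X)\hat N_{\rho_iq}(-\beta_1X)$ and $R_i(X)=\hat N_{\rho_iq}(\beta_1X)\hat N_{\rho_i}(-\beta_1X)$ have coefficients in $\mathbb F_q$, the polynomials $\hat P(bX)$, $\hat Q_i(bX)$, $\hat R_i(bX)$ are irreducible over $\mathbb F_q$, and $$X^{N}-\lambda=\hat P(bX)^{p^n}\prod_{i=1}^{e}\hat Q_i(bX)^{p^n}\hat R_i(bX)^{p^n}.$$ The $\lambda$-constacyclic codes of length $N$ over $\mathbb F_q$ are exactly the codes $$C=\Big\langle\hat P(bX)^{\varepsilon}\prod_{i=1}^{e}\hat Q_i(bX)^{\varepsilon_i}\hat R_i(bX)^{\epsilon_i}\Big\rangle,\qquad 0\le\varepsilon,\varepsilon_i,\epsilon_i\le p^n,\quad 1\le i\le e,$$ and the exponents are uniquely determined by $C$. -/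

import Mathlib

open Polynomial

/-- The `Q`-cyclotomic coset `{t, tQ, tQ², …}` of `t` modulo `M`. -/
def cyclotomicCoset (Q M : ℕ) (t : ZMod M) : Set (ZMod M) :=
  {x | ∃ j : ℕ, x = t * (Q : ZMod M) ^ j}

/-- `ρ 0, …, ρ e` represent all the `Q`-cyclotomic cosets modulo `M`, each of them exactly once,
and the first representative is `0`. -/
def IsCosetEnumeration (Q M : ℕ) {e : ℕ} (ρ : Fin (e + 1) → ZMod M) : Prop :=
  ρ 0 = 0 ∧ ∀ t : ZMod M, ∃! i, cyclotomicCoset Q M t = cyclotomicCoset Q M (ρ i)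

/-- The polynomial `∏ (X - η ^ s)`, where `s` runs over the `Q`-cyclotomic coset of `t` modulo
`M`. -/
noncomputable def cosetPoly {L : Type*} [Field L] (Q M : ℕ) (η : L) (t : ZMod M) : L[X] :=
  ∏ᶠ s ∈ cyclotomicCoset Q M t, (X - C (η ^ s.val))

/-- The minimal polynomial of `η ^ t` over `F`. -/
noncomputable def rootMinpoly (F : Type*) {L : Type*} [Field F] [Field L] [Algebra F L]
    {M : ℕ} (η : L) (t : ZMod M) : F[X] :=
  minpoly F (η ^ t.val)

/-- The monic polynomial obtained by dividing `f(aX)` by its leading coefficient. -/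
noncomputable def hatScale {F : Type*} [Field F] (f : F[X]) (a : F) : F[X] :=
  C (f.comp (C a * X)).leadingCoeff⁻¹ * f.comp (C a * X)

/-- The constacyclic shift `(c₀, …, c_{N-1}) ↦ (lam * c_{N-1}, c₀, …, c_{N-2})`. -/
def constaShift {F : Type*} [Field F] {N : ℕ} (lam : F) (c : Fin N → F) : Fin N → F :=
  fun i => if (i : ℕ) = 0 then lam * c ⟨N - 1, by have := i.isLt; omega⟩
    else c ⟨(i : ℕ) - 1, by have := i.isLt; omega⟩

/-- The linear code `D` is `lam`-constacyclic. -/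
def IsConstacyclic {F : Type*} [Field F] {N : ℕ} (lam : F) (D : Submodule F (Fin N → F)) : Prop :=
  ∀ c ∈ D, constaShift lam c ∈ D

/-- The polynomial `c₀ + c₁ X + ⋯ + c_{N-1} X^{N-1}` of a word. -/
noncomputable def wordPoly {F : Type*} [Field F] {N : ℕ} (c : Fin N → F) : F[X] :=
  ∑ i : Fin N, C (c i) * X ^ (i : ℕ)

/-- `g` is the generator polynomial of `D` as a `lam`-constacyclic code: `g` is a monic divisor of
`X ^ N - lam`, and `D` corresponds to the ideal generated by `g` in `F[X] / (X ^ N - lam)`. -/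
def IsGeneratorPoly {F : Type*} [Field F] {N : ℕ} (lam : F) (D : Submodule F (Fin N → F))
    (g : F[X]) : Prop :=
  g.Monic ∧ g ∣ X ^ N - C lam ∧
    ∀ c : Fin N → F, c ∈ D ↔
      Ideal.Quotient.mk (Ideal.span {(X ^ N - C lam : F[X])}) (wordPoly c) ∈
        Ideal.span {Ideal.Quotient.mk (Ideal.span {(X ^ N - C lam : F[X])}) g}

/-! Write M = ℓ^m and k = 2M. Some μ satisfies μ^(p^n) = λ, so X^N - λ = (X^k - μ)^(p^n), with X^k -
μ separable because p does not divide k. Constacyclic codes correspond to the ideals of F[X]/(X^N -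
λ), hence to monic divisors of X^N - λ, hence to exponent vectors over the irreducible factors of
X^k - μ (`isConstacyclic_iff_existsUnique`). It remains to find these factors.

If λ is a square, take μ = a^(-k). As M is odd, rescaling X^M - 1 by a and by -a gives the two
halves of X^k - μ, and X^M - 1 is the product of the minimal polynomials of the η^(ρ i).

Otherwise, take μ = ξ b^(-k); rescaling by b reduces to X^k - ξ. Since β^(-k) = ξ, the roots are
±η^s/β, and β^q = -β makes Frobenius send η^s/β to -η^(sq)/β. The orbit of η^t/β therefore takes the
sign + over the q²-coset of t and the sign - over that of tq: these are the roots of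
`twistedCosetPoly`, which descends to F (`exists_map_eq_twistedCosetPoly`) and is irreducible
(`irreducible_of_map_eq_twistedCosetPoly`). For odd f the q²-cosets of t and tq coincide with the
q-coset, which yields the S_i. For even f and t ≠ 0 they are disjoint, so t and tq yield two factors
Q_i and R_i; t = 0 yields P. -/

section HatScale

/-! ### Rescaling the variable. -/

variable {F : Type*} [Field F]

theorem comp_C_mul_X_ne_zero {f : F[X]} (hf : f ≠ 0) {a : F} (ha : a ≠ 0) :
    f.comp (C a * X) ≠ 0 := by
  intro h
  have h2 := congrArg (fun g => g.comp (C a⁻¹ * X)) h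
  simp only [comp_assoc, mul_comp, C_comp, X_comp, zero_comp] at h2
  rw [← mul_assoc, ← C_mul, mul_inv_cancel₀ ha, C_1, one_mul, comp_X] at h2
  exact hf h2

theorem hatScale_monic {f : F[X]} (hf : f ≠ 0) {a : F} (ha : a ≠ 0) : (hatScale f a).Monic := by
  rw [hatScale, mul_comm]
  exact monic_mul_leadingCoeff_inv (comp_C_mul_X_ne_zero hf ha)

theorem hatScale_mul (f g : F[X]) (a : F) :
    hatScale (f * g) a = hatScale f a * hatScale g a := by
  simp only [hatScale, mul_comp, leadingCoeff_mul, mul_inv, C_mul]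
  ring

theorem hatScale_one (a : F) : hatScale (1 : F[X]) a = 1 := by
  simp [hatScale]

theorem hatScale_prod {ι : Type*} (s : Finset ι) (f : ι → F[X]) (a : F) :
    hatScale (∏ i ∈ s, f i) a = ∏ i ∈ s, hatScale (f i) a := by
  classical
  induction s using Finset.induction_on with
  | empty => simp [hatScale_one]
  | insert i s hi ih => rw [Finset.prod_insert hi, Finset.prod_insert hi, hatScale_mul, ih]

theorem map_hatScale {E : Type*} [Field E] (σ : F →+* E) (f : F[X]) (a : F) :
    (hatScale f a).map σ = hatScale (f.map σ) (σ a) := by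
  have h : (f.map σ).comp (C (σ a) * X) = (f.comp (C a * X)).map σ := by
    rw [Polynomial.map_comp]; simp
  rw [hatScale, hatScale, h, leadingCoeff_map]
  simp

theorem hatScale_X_pow_sub_C {k : ℕ} (hk : k ≠ 0) (c : F) {a : F} (ha : a ≠ 0) :
    hatScale (X ^ k - C c) a = X ^ k - C (c * (a ^ k)⁻¹) := by
  have h : (X ^ k - C c : F[X]).comp (C a * X) = C (a ^ k) * (X ^ k - C (c * (a ^ k)⁻¹)) := by
    simp only [sub_comp, pow_comp, X_comp, C_comp, mul_pow, mul_sub, ← C_mul, ← C_pow]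
    rw [mul_left_comm, mul_inv_cancel₀ (pow_ne_zero k ha), mul_one]
  rw [hatScale, h, leadingCoeff_mul, leadingCoeff_C, (monic_X_pow_sub_C _ hk).leadingCoeff,
    mul_one, ← mul_assoc, ← C_mul, inv_mul_cancel₀ (pow_ne_zero k ha), C_1, one_mul]

theorem hatScale_X_sub_C (c : F) {a : F} (ha : a ≠ 0) :
    hatScale (X - C c) a = X - C (c * a⁻¹) := by
  simpa using hatScale_X_pow_sub_C one_ne_zero c ha

theorem hatScale_irreducible {f : F[X]} (hf : Irreducible f) {a : F} (ha : a ≠ 0) :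
    Irreducible (hatScale f a) := by
  let : Invertible a := invertibleOfNonzero ha
  have h : Irreducible (f.comp (C a * X)) := by
    -- The substitution X ↦ aX is an automorphism of F[X].
    have h2 := (MulEquiv.irreducible_iff (algEquivCMulXAddC a (0 : F))).2 hf
    simpa [algEquivCMulXAddC_apply, aeval_def, eval₂_eq_eval_map, comp] using h2
  have hu : IsUnit (C (f.comp (C a * X)).leadingCoeff⁻¹ : F[X]) := by
    rw [isUnit_C, isUnit_iff_ne_zero]
    exact inv_ne_zero (leadingCoeff_ne_zero.2 h.ne_zero)
  exact (irreducible_isUnit_mul hu).2 h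

end HatScale

/-! ### Constacyclic codes and generator polynomials. -/

section Codes

variable {F : Type*} [Field F]

theorem coeff_wordPoly {N : ℕ} (c : Fin N → F) (j : ℕ) :
    (wordPoly c).coeff j = if h : j < N then c ⟨j, h⟩ else 0 := by
  simp only [wordPoly, finsetSum_coeff, coeff_C_mul_X_pow]
  split_ifs with h
  · rw [Finset.sum_eq_single ⟨j, h⟩]
    · simp
    · intro b _ hb
      rw [if_neg]
      rintro rfl
      exact hb rfl
    · simp
  · refine Finset.sum_eq_zero fun i _ => if_neg ?_
    rintro rfl
    exact h i.isLt

theorem degree_wordPoly_lt {N : ℕ} (c : Fin N → F) : (wordPoly c).degree < N := by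
  rw [degree_lt_iff_coeff_zero]
  intro j hj
  rw [coeff_wordPoly, dif_neg (not_lt.2 hj)]

theorem wordPoly_coeff {N : ℕ} {h : F[X]} (hd : h.degree < N) :
    wordPoly (fun i : Fin N => h.coeff i) = h := by
  ext j
  rw [coeff_wordPoly]
  split_ifs with hj
  · rfl
  · exact ((degree_lt_iff_coeff_zero h N).1 hd j (not_lt.1 hj)).symm

/-- The shift is multiplication by X followed by replacing X^N with λ; this makes shift-invariance
an ideal condition. -/
theorem wordPoly_constaShift {N : ℕ} (hN : 0 < N) (lam : F) (c : Fin N → F) :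
    wordPoly (constaShift lam c) =
      X * wordPoly c - C (c ⟨N - 1, Nat.sub_one_lt hN.ne'⟩) * (X ^ N - C lam) := by
  ext j
  rw [coeff_wordPoly, coeff_sub, coeff_C_mul, coeff_sub, coeff_X_pow, coeff_C]
  cases j with
  | zero => simp [hN, hN.ne, constaShift, mul_comm]
  | succ j =>
    rw [coeff_X_mul, coeff_wordPoly]
    simp only [constaShift, Nat.add_one_ne_zero, if_false, Nat.add_sub_cancel, sub_zero]
    split_ifs with h1 h2 h3 h4 h5 h6
    · omega
    · simp
    · omega
    · omega
    · have : N - 1 = j := by omega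
      subst this
      simp
    · omega
    · omega
    · simp

/-- As g divides X^N - λ, divisibility by g in the quotient can be tested in F[X]. -/
theorem isGeneratorPoly_iff {N : ℕ} {lam : F} {D : Submodule F (Fin N → F)} {g : F[X]} :
    IsGeneratorPoly lam D g ↔
      g.Monic ∧ g ∣ X ^ N - C lam ∧ ∀ c : Fin N → F, c ∈ D ↔ g ∣ wordPoly c := by
  refine and_congr_right fun _ => and_congr_right fun hd => forall_congr' fun c => ?_
  have h : (Ideal.Quotient.mk (Ideal.span {(X ^ N - C lam : F[X])}) (wordPoly c) ∈
      Ideal.span {Ideal.Quotient.mk (Ideal.span {(X ^ N - C lam : F[X])}) g}) ↔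
      g ∣ wordPoly c := by
    rw [Ideal.mem_span_singleton]
    constructor
    · rintro ⟨y, hy⟩
      obtain ⟨y, rfl⟩ := Ideal.Quotient.mk_surjective y
      rw [← map_mul, Ideal.Quotient.eq, Ideal.mem_span_singleton] at hy
      have := (hd.trans hy).add (dvd_mul_right g y)
      simpa using this
    · exact fun h => map_dvd _ h
  rw [h]

theorem IsGeneratorPoly.isConstacyclic {N : ℕ} (hN : 0 < N) {lam : F}
    {D : Submodule F (Fin N → F)} {g : F[X]} (h : IsGeneratorPoly lam D g) :
    IsConstacyclic lam D := by
  obtain ⟨-, hd, hc⟩ := isGeneratorPoly_iff.1 h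
  intro c hcD
  rw [hc, wordPoly_constaShift hN]
  exact (((hc c).1 hcD).mul_left _).sub (hd.mul_left _)

theorem IsGeneratorPoly.dvd {N : ℕ} (hN : 0 < N) {lam : F}
    {D : Submodule F (Fin N → F)} {g g' : F[X]} (h : IsGeneratorPoly lam D g)
    (h' : IsGeneratorPoly lam D g') : g' ∣ g := by
  obtain ⟨hm, hd, hc⟩ := isGeneratorPoly_iff.1 h
  obtain ⟨-, hd', hc'⟩ := isGeneratorPoly_iff.1 h'
  have hf : (X ^ N - C lam : F[X]).Monic := monic_X_pow_sub_C _ hN.ne'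
  have hle := degree_le_of_dvd hd hf.ne_zero
  rw [degree_X_pow_sub_C hN] at hle
  rcases hle.lt_or_eq with hlt | heq
  -- Below degree N, g is itself a word of the code; in degree N, it equals X^N - λ, a multiple of
  -- g'.
  · rw [← wordPoly_coeff hlt, ← hc', hc, wordPoly_coeff hlt]
  · rwa [← eq_of_monic_of_dvd_of_natDegree_le hm hf hd
      (by rw [natDegree_X_pow_sub_C, natDegree_eq_of_degree_eq_some heq])]

theorem IsGeneratorPoly.unique {N : ℕ} (hN : 0 < N) {lam : F}
    {D : Submodule F (Fin N → F)} {g g' : F[X]} (h : IsGeneratorPoly lam D g)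
    (h' : IsGeneratorPoly lam D g') : g = g' :=
  eq_of_monic_of_associated h.1 h'.1 (associated_of_dvd_dvd (h'.dvd hN h) (h.dvd hN h'))

theorem IsConstacyclic.exists_isGeneratorPoly {N : ℕ} (hN : 0 < N) {lam : F}
    {D : Submodule F (Fin N → F)} (h : IsConstacyclic lam D) :
    ∃ g, IsGeneratorPoly lam D g := by
  have hf : (X ^ N - C lam : F[X]).Monic := monic_X_pow_sub_C _ hN.ne'
  have hword : ∀ c : Fin N → F, wordPoly c %ₘ (X ^ N - C lam) = wordPoly c := fun c => by
    rw [modByMonic_eq_self_iff hf, degree_X_pow_sub_C hN]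
    exact degree_wordPoly_lt c
  -- `T` reduces modulo X^N - λ and reads off coefficients. The preimage of `D` under `T` is an
  -- ideal of a principal ideal domain; its normalised generator is the one sought.
  let T : F[X] →ₗ[F] (Fin N → F) :=
    LinearMap.pi fun i => (lcoeff F (i : ℕ)).comp (modByMonicHom (X ^ N - C lam))
  have hT : ∀ r, wordPoly (T r) = r %ₘ (X ^ N - C lam) := fun r => by
    refine wordPoly_coeff ?_
    rw [← degree_X_pow_sub_C hN lam]
    exact degree_modByMonic_lt _ hf
  have hTw : ∀ c, T (wordPoly c) = c := fun c => by
    funext i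
    change (wordPoly c %ₘ (X ^ N - C lam)).coeff i = c i
    rw [hword, coeff_wordPoly, dif_pos i.isLt]
  have hTX : ∀ r, T (X * r) = constaShift lam (T r) := fun r => by
    rw [← hTw (constaShift lam (T r))]
    funext i
    change ((X * r) %ₘ (X ^ N - C lam)).coeff i =
      (wordPoly (constaShift lam (T r)) %ₘ (X ^ N - C lam)).coeff i
    congr 1
    rw [wordPoly_constaShift hN, hT, ← sub_eq_zero, ← sub_modByMonic,
      modByMonic_eq_zero_iff_dvd hf]
    have h1 : (X ^ N - C lam) ∣ r - r %ₘ (X ^ N - C lam) :=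
      ⟨_, sub_eq_of_eq_add' (modByMonic_add_div r (X ^ N - C lam)).symm⟩
    have h2 := (h1.mul_left X).add
      (dvd_mul_left (X ^ N - C lam) (C (T r ⟨N - 1, Nat.sub_one_lt hN.ne'⟩)))
    convert h2 using 1
    ring
  have hmul : ∀ s r, T r ∈ D → T (s * r) ∈ D := by
    intro s
    induction s using Polynomial.induction_on with
    | C a =>
      intro r hr
      rw [← smul_eq_C_mul, map_smul]
      exact D.smul_mem a hr
    | add s t hs ht =>
      intro r hr
      rw [add_mul, map_add]
      exact D.add_mem (hs r hr) (ht r hr)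
    | monomial k a ih =>
      intro r hr
      rw [pow_succ, ← mul_assoc, mul_assoc]
      exact ih _ (by rw [hTX]; exact h _ hr)
  let I : Ideal F[X] :=
    { carrier := {r | T r ∈ D}
      add_mem' := fun {a b} ha hb => by
        change T (a + b) ∈ D
        rw [map_add]
        exact D.add_mem ha hb
      zero_mem' := by
        change T 0 ∈ D
        rw [map_zero]
        exact D.zero_mem
      smul_mem' := fun s r hr => hmul s r hr }
  obtain ⟨g, hg⟩ := (IsPrincipalIdealRing.principal I).principal
  have hI : ∀ r, T r ∈ D ↔ g ∣ r := fun r => by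
    rw [← Ideal.mem_span_singleton]
    change r ∈ I ↔ _
    rw [hg]
  have hfI : g ∣ X ^ N - C lam := by
    rw [← hI]
    have : T (X ^ N - C lam) = 0 := by
      funext i
      change ((X ^ N - C lam) %ₘ (X ^ N - C lam) : F[X]).coeff i = 0
      rw [modByMonic_self hf, coeff_zero]
    rw [this]
    exact D.zero_mem
  have hg0 : g ≠ 0 := ne_zero_of_dvd_ne_zero hf.ne_zero hfI
  have hass : Associated (g * C g.leadingCoeff⁻¹) g :=
    associated_mul_unit_left _ _ (isUnit_C.2 (isUnit_iff_ne_zero.2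
      (inv_ne_zero (leadingCoeff_ne_zero.2 hg0))))
  refine ⟨g * C g.leadingCoeff⁻¹, isGeneratorPoly_iff.2
    ⟨monic_mul_leadingCoeff_inv hg0, hass.dvd_iff_dvd_left.2 hfI, fun c => ?_⟩⟩
  rw [hass.dvd_iff_dvd_left, ← hI, hTw]

end Codes

/-! ### Divisors of a product of prime powers. -/

section Exponents

variable {F : Type*} [Field F]

theorem exists_eq_prod_pow_of_dvd {ι : Type*} {G : ι → F[X]} (hG : ∀ i, Irreducible (G i))
    (hGm : ∀ i, (G i).Monic) (k : ℕ) (s : Finset ι) :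
    ∀ g : F[X], g.Monic → g ∣ ∏ i ∈ s, G i ^ k →
      ∃ ε : ι → ℕ, (∀ i, ε i ≤ k) ∧ g = ∏ i ∈ s, G i ^ ε i := by
  classical
  induction s using Finset.induction_on with
  | empty =>
    intro g hm hg
    refine ⟨0, fun i => Nat.zero_le _, ?_⟩
    rw [Finset.prod_empty] at hg ⊢
    exact hm.eq_one_of_isUnit (isUnit_of_dvd_one hg)
  | insert i s hi ih =>
    intro g hm hg
    rw [Finset.prod_insert hi] at hg
    obtain ⟨a, b, ha, hb, rfl⟩ := exists_dvd_and_dvd_of_dvd_mul hg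
    have hP : (∏ j ∈ s, G j ^ k) ≠ 0 :=
      Finset.prod_ne_zero_iff.2 fun j _ => pow_ne_zero k (hG j).ne_zero
    have hb0 : b ≠ 0 := ne_zero_of_dvd_ne_zero hP hb
    have hbass : Associated (b * C b.leadingCoeff⁻¹) b :=
      associated_mul_unit_left _ _ (isUnit_C.2 (isUnit_iff_ne_zero.2
        (inv_ne_zero (leadingCoeff_ne_zero.2 hb0))))
    -- The cofactor `b` need not be monic, so it is normalised before the induction hypothesis
    -- applies.
    obtain ⟨ε, hε, hbε⟩ := ih (b * C b.leadingCoeff⁻¹) (monic_mul_leadingCoeff_inv hb0)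
      (hbass.dvd_iff_dvd_left.2 hb)
    obtain ⟨r, hr, har⟩ := (dvd_prime_pow (hG i).prime k).1 ha
    refine ⟨Function.update ε i r, fun j => ?_, ?_⟩
    · rcases eq_or_ne j i with rfl | hj
      · simpa using hr
      · simpa [hj] using hε j
    · have hrest : ∏ j ∈ s, G j ^ Function.update ε i r j = ∏ j ∈ s, G j ^ ε j :=
        Finset.prod_congr rfl fun j hj => by
          rw [Function.update_of_ne (ne_of_mem_of_not_mem hj hi)]
      rw [Finset.prod_insert hi, Function.update_self, hrest]
      refine eq_of_monic_of_associated hm (((hGm i).pow r).mul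
        (monic_prod_of_monic _ _ fun j _ => (hGm j).pow _)) ?_
      rw [← hbε]
      exact har.mul_mul hbass.symm

theorem exponent_le_of_prod_pow_eq {ι : Type*} [Fintype ι] {G : ι → F[X]}
    (hG : ∀ i, Irreducible (G i)) (hc : Pairwise fun i j => IsCoprime (G i) (G j))
    {ε ε' : ι → ℕ} (h : ∏ i, G i ^ ε i = ∏ i, G i ^ ε' i) (i : ι) : ε i ≤ ε' i := by
  classical
  have h1 : G i ^ ε i ∣ ∏ j, G j ^ ε' j := h ▸ Finset.dvd_prod_of_mem _ (Finset.mem_univ i)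
  rw [← Finset.mul_prod_erase _ _ (Finset.mem_univ i)] at h1
  have h2 : IsCoprime (G i ^ ε i) (∏ j ∈ Finset.univ.erase i, G j ^ ε' j) :=
    IsCoprime.prod_right fun j hj => (hc (Finset.ne_of_mem_erase hj).symm).pow
  exact (pow_dvd_pow_iff (hG i).ne_zero (hG i).not_isUnit).1 (h2.dvd_of_dvd_mul_right h1)

/-- If `X ^ k - μ` is separable and factors into the monic irreducible polynomials `G i`, then the
constacyclic codes belonging to its `p ^ n`-th power correspond to the exponent vectors bounded by
`p ^ n`. -/
theorem isConstacyclic_iff_existsUnique {ι : Type*} [Fintype ι] (p : ℕ) [Fact p.Prime] [CharP F p]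
    {n k : ℕ} (hk : (k : F) ≠ 0) {μ lam : F} (hμ : μ ≠ 0) (hμl : μ ^ p ^ n = lam)
    {G : ι → F[X]} (hG : ∀ i, Irreducible (G i)) (hGm : ∀ i, (G i).Monic)
    (hprod : ∏ i, G i = X ^ k - C μ) :
    X ^ (k * p ^ n) - C lam = ∏ i, G i ^ p ^ n ∧
    ∀ D : Submodule F (Fin (k * p ^ n) → F), IsConstacyclic lam D ↔
      ∃! ε : ι → ℕ, (∀ i, ε i ≤ p ^ n) ∧ IsGeneratorPoly lam D (∏ i, G i ^ ε i) := by
  have hfac : (X ^ (k * p ^ n) - C lam : F[X]) = ∏ i, G i ^ p ^ n := by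
    rw [Finset.prod_pow, hprod, sub_pow_char_pow, ← pow_mul, ← C_pow, hμl]
  have hN : 0 < k * p ^ n := by
    refine Nat.mul_pos (Nat.pos_of_ne_zero ?_) (pow_pos (Fact.out : p.Prime).pos n)
    rintro rfl
    simp at hk
  have hcop : Pairwise fun i j => IsCoprime (G i) (G j) := by
    classical
    have hs : (∏ i, G i).Separable := hprod ▸ separable_X_pow_sub_C μ hk hμ
    intro i j hij
    rw [← Finset.mul_prod_erase _ _ (Finset.mem_univ i)] at hs
    exact hs.isCoprime.of_isCoprime_of_dvd_right
      (Finset.dvd_prod_of_mem _ (Finset.mem_erase.2 ⟨hij.symm, Finset.mem_univ j⟩))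
  refine ⟨hfac, fun D => ⟨fun hD => ?_, fun ⟨ε, hε, _⟩ => hε.2.isConstacyclic hN⟩⟩
  obtain ⟨g, hg⟩ := hD.exists_isGeneratorPoly hN
  obtain ⟨ε, hε, rfl⟩ := exists_eq_prod_pow_of_dvd hG hGm (p ^ n) Finset.univ g hg.1
    (hfac ▸ hg.2.1)
  refine ⟨ε, ⟨hε, hg⟩, fun ε' hε' => ?_⟩
  have := hg.unique hN hε'.2
  exact funext fun i => le_antisymm (exponent_le_of_prod_pow_eq hG hcop this.symm i)
    (exponent_le_of_prod_pow_eq hG hcop this i)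

end Exponents

/-! ### Descent and irreducibility through Frobenius. -/

section FiniteFieldDescent

variable {F E : Type*} [Field F] [Fintype F] [Field E] [Algebra F E]

/-- X^q - X already splits over F, so it has no further roots in E. -/
theorem exists_algebraMap_eq_of_pow_card_eq {x : E} (hx : x ^ Fintype.card F = x) :
    ∃ a : F, algebraMap F E a = x := by
  have hprod : (X ^ Fintype.card F - X : F[X]) = ∏ a : F, (X - C a) := by
    have hm : (X ^ Fintype.card F - X : F[X]).Monic :=
      monic_X_pow_sub (by rw [degree_X]; exact_mod_cast Fintype.one_lt_card)
    have h := prod_multiset_X_sub_C_of_monic_of_roots_card_eq hm (by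
      rw [FiniteField.roots_X_pow_card_sub_X,
        FiniteField.X_pow_card_sub_X_natDegree_eq F Fintype.one_lt_card]
      simp)
    rw [FiniteField.roots_X_pow_card_sub_X] at h
    exact h.symm
  have h := congrArg (aeval x) hprod
  simp only [map_sub, map_pow, aeval_X, map_prod, aeval_C] at h
  rw [hx, sub_self, eq_comm, Finset.prod_eq_zero_iff] at h
  obtain ⟨a, -, ha⟩ := h
  exact ⟨a, (sub_eq_zero.1 ha).symm⟩

theorem exists_map_algebraMap_eq {σ : E →+* E} (hσ : ∀ x, σ x = x ^ Fintype.card F) {h : E[X]}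
    (hh : h.map σ = h) : ∃ g : F[X], g.map (algebraMap F E) = h := by
  have : h ∈ lifts (algebraMap F E) := by
    rw [lifts_iff_coeff_lifts]
    intro k
    refine exists_algebraMap_eq_of_pow_card_eq (F := F) ?_
    rw [← hσ, ← coeff_map, hh]
  exact (mem_lifts h).1 this

theorem aeval_pow_card_pow_eq_zero {g : F[X]} {x : E} (hx : aeval x g = 0) (j : ℕ) :
    aeval (x ^ Fintype.card F ^ j) g = 0 := by
  induction j with
  | zero => simpa using hx
  | succ j ih =>
    have h := aeval_algHom_apply (FiniteField.frobeniusAlgHom F E) (x ^ Fintype.card F ^ j) g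
    rw [ih, map_zero, FiniteField.coe_frobeniusAlgHom] at h
    rw [pow_succ, pow_mul]
    exact h

/-- If the cofactor of the minimal polynomial of x were not constant, it would have a root in the
orbit of x. That root is also a root of the minimal polynomial, against separability. -/
theorem irreducible_of_roots_frobenius_orbit {g : F[X]} (hs : g.Separable) {x : E}
    (hspl : (g.map (algebraMap F E)).Splits) (hx : aeval x g = 0)
    (horb : ∀ y, aeval y g = 0 → ∃ j, y = x ^ Fintype.card F ^ j) : Irreducible g := by
  have hint : IsIntegral F x := IsAlgebraic.isIntegral ⟨g, hs.ne_zero, hx⟩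
  obtain ⟨h, hgh⟩ := minpoly.dvd F x hx
  have hu : IsUnit h := by
    by_contra hu
    have h0 : h ≠ 0 := by
      rintro rfl
      exact hs.ne_zero (by rw [hgh, mul_zero])
    have hsh : (h.map (algebraMap F E)).Splits := by
      refine hspl.of_dvd ?_ (Polynomial.map_dvd _ (hgh ▸ dvd_mul_left _ _))
      exact (Polynomial.map_ne_zero hs.ne_zero)
    obtain ⟨z, hz⟩ := hsh.exists_eval_eq_zero (by
      rw [degree_map]
      exact fun hd => hu (isUnit_iff_degree_eq_zero.2 hd))
    have hzh : aeval z h = 0 := by rwa [eval_map_algebraMap] at hz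
    obtain ⟨j, rfl⟩ := horb z (by rw [hgh, map_mul, hzh, mul_zero])
    obtain ⟨a, b, hab⟩ := (hgh ▸ hs : (minpoly F x * h).Separable).isCoprime
    have h1 := congrArg (aeval (x ^ Fintype.card F ^ j)) hab
    simp only [map_add, map_mul, map_one, hzh,
      aeval_pow_card_pow_eq_zero (minpoly.aeval F x) j] at h1
    simp at h1
  rw [hgh, irreducible_mul_isUnit hu]
  exact minpoly.irreducible hint

end FiniteFieldDescent

/-! ### Cyclotomic cosets for Q and Q². -/

section Cosets

variable {Q M : ℕ}

theorem mem_cyclotomicCoset_self (t : ZMod M) : t ∈ cyclotomicCoset Q M t := ⟨0, by simp⟩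

theorem natCast_pow_totient (hQ : Q.Coprime M) : (Q : ZMod M) ^ M.totient = 1 := by
  have h := (ZMod.natCast_eq_natCast_iff _ _ _).2 (Nat.ModEq.pow_totient hQ)
  simpa using h

/-- By Euler's theorem a natural power of Q inverts Q^j, which makes coset membership symmetric. -/
theorem mul_pow_mul_pow_cancel [NeZero M] (hQ : Q.Coprime M) (t : ZMod M) (j : ℕ) :
    t * (Q : ZMod M) ^ j * (Q : ZMod M) ^ (M.totient * j - j) = t := by
  have hM : 0 < M.totient := Nat.totient_pos.2 (NeZero.pos M)
  have hle : j ≤ M.totient * j := Nat.le_mul_of_pos_left j hM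
  rw [mul_assoc, ← pow_add, Nat.add_sub_cancel' hle, pow_mul, natCast_pow_totient hQ, one_pow,
    mul_one]

theorem cyclotomicCoset_eq_of_mem [NeZero M] (hQ : Q.Coprime M) {s t : ZMod M}
    (h : s ∈ cyclotomicCoset Q M t) : cyclotomicCoset Q M s = cyclotomicCoset Q M t := by
  obtain ⟨j, rfl⟩ := h
  ext x
  constructor
  · rintro ⟨k, rfl⟩
    exact ⟨j + k, by rw [pow_add, mul_assoc]⟩
  · rintro ⟨k, rfl⟩
    refine ⟨M.totient * j - j + k, ?_⟩
    rw [pow_add, ← mul_assoc, mul_pow_mul_pow_cancel hQ]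

theorem cyclotomicCoset_eq_iff [NeZero M] (hQ : Q.Coprime M) {s t : ZMod M} :
    cyclotomicCoset Q M s = cyclotomicCoset Q M t ↔ s ∈ cyclotomicCoset Q M t :=
  ⟨fun h => h ▸ mem_cyclotomicCoset_self s, cyclotomicCoset_eq_of_mem hQ⟩

theorem cyclotomicCoset_zero : cyclotomicCoset Q M 0 = {0} := by
  ext x
  simp [cyclotomicCoset]

theorem cyclotomicCoset_mul_natCast (q : ℕ) (t : ZMod M) :
    cyclotomicCoset Q M (t * q) = (fun s => s * (q : ZMod M)) '' cyclotomicCoset Q M t := by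
  ext x
  constructor
  · rintro ⟨j, rfl⟩
    exact ⟨t * Q ^ j, ⟨j, rfl⟩, by ring⟩
  · rintro ⟨_, ⟨j, rfl⟩, rfl⟩
    exact ⟨j, by ring⟩

theorem cyclotomicCoset_sq_union (t : ZMod M) :
    cyclotomicCoset (Q ^ 2) M t ∪ cyclotomicCoset (Q ^ 2) M (t * Q) = cyclotomicCoset Q M t := by
  ext x
  constructor
  · rintro (⟨j, rfl⟩ | ⟨j, rfl⟩)
    · exact ⟨2 * j, by push_cast; rw [← pow_mul]⟩
    · exact ⟨2 * j + 1, by push_cast; rw [← pow_mul]; ring⟩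
  · rintro ⟨j, rfl⟩
    rcases Nat.even_or_odd' j with ⟨k, rfl | rfl⟩
    · exact Or.inl ⟨k, by push_cast; rw [← pow_mul]⟩
    · exact Or.inr ⟨k, by push_cast; rw [← pow_mul]; ring⟩

theorem cyclotomicCoset_sq_mul_mul [NeZero M] (hQ : Q.Coprime M) (t : ZMod M) :
    cyclotomicCoset (Q ^ 2) M (t * Q * Q) = cyclotomicCoset (Q ^ 2) M t :=
  cyclotomicCoset_eq_of_mem (hQ.pow_left 2) ⟨1, by push_cast; ring⟩

/-- If some odd power of `Q` fixes `t`, then the `Q`- and the `Q ^ 2`-coset of `t` agree. -/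
theorem cyclotomicCoset_sq_of_odd [NeZero M] (hQ : Q.Coprime M) {t : ZMod M} {j : ℕ} (hj : Odd j)
    (h : t * (Q : ZMod M) ^ j = t) :
    cyclotomicCoset (Q ^ 2) M t = cyclotomicCoset Q M t ∧
      cyclotomicCoset (Q ^ 2) M (t * Q) = cyclotomicCoset Q M t := by
  have h1 : cyclotomicCoset (Q ^ 2) M t = cyclotomicCoset (Q ^ 2) M (t * Q) := by
    obtain ⟨k, rfl⟩ := hj
    -- Here t = (tQ)(Q²)^k lies in the Q²-coset of tQ.
    refine cyclotomicCoset_eq_of_mem (hQ.pow_left 2) ⟨k, ?_⟩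
    push_cast
    rw [← pow_mul]
    linear_combination -h
  have h2 := cyclotomicCoset_sq_union (Q := Q) t
  rw [← h1, Set.union_self] at h2
  exact ⟨h2, h1 ▸ h2⟩

/-- A common element would put t in the Q²-coset of tQ, so that an odd power of Q would fix t. -/
theorem disjoint_cyclotomicCoset_sq [NeZero M] (hQ : Q.Coprime M) {t : ZMod M}
    (h : ∀ j, Odd j → t * (Q : ZMod M) ^ j ≠ t) :
    Disjoint (cyclotomicCoset (Q ^ 2) M t) (cyclotomicCoset (Q ^ 2) M (t * Q)) := by
  rw [Set.disjoint_left]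
  rintro x hx hx'
  have h1 := (cyclotomicCoset_eq_of_mem (hQ.pow_left 2) hx).symm.trans
    (cyclotomicCoset_eq_of_mem (hQ.pow_left 2) hx')
  obtain ⟨j, hj⟩ := h1 ▸ mem_cyclotomicCoset_self t
  refine h (2 * j + 1) ⟨j, rfl⟩ ?_
  conv_rhs => rw [hj]
  push_cast
  rw [← pow_mul]
  ring

end Cosets

/-! ### Coset polynomials and minimal polynomials. -/

section CosetPoly

variable {L : Type*} [Field L] {Q M : ℕ} {η : L}

theorem cosetPoly_congr {Q' : ℕ} {s t : ZMod M}
    (h : cyclotomicCoset Q M s = cyclotomicCoset Q' M t) :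
    cosetPoly Q M η s = cosetPoly Q' M η t := by
  rw [cosetPoly, cosetPoly, h]

theorem cosetPoly_zero : cosetPoly Q M η 0 = X - 1 := by
  rw [cosetPoly, cyclotomicCoset_zero, finprod_mem_singleton]
  simp

variable [NeZero M]

theorem pow_val_mul_natCast (hη : η ^ M = 1) (s : ZMod M) (q : ℕ) :
    η ^ (s * (q : ZMod M)).val = (η ^ s.val) ^ q := by
  rw [← pow_mul]
  refine pow_eq_pow_of_modEq ?_ hη
  rw [← ZMod.natCast_eq_natCast_iff]
  simp

theorem pow_val_injective (hη : IsPrimitiveRoot η M) :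
    Function.Injective fun s : ZMod M => η ^ s.val := fun s t h =>
  ZMod.val_injective M (hη.pow_inj (ZMod.val_lt s) (ZMod.val_lt t) h)

theorem cosetPoly_eq_prod (t : ZMod M) : ∃ T : Finset (ZMod M),
    (∀ s, s ∈ T ↔ s ∈ cyclotomicCoset Q M t) ∧
      cosetPoly Q M η t = ∏ s ∈ T, (X - C (η ^ s.val)) := by
  have hfin : (cyclotomicCoset Q M t).Finite := Set.toFinite _
  exact ⟨hfin.toFinset, fun s => hfin.mem_toFinset,
    finprod_mem_eq_finite_toFinset_prod _ hfin⟩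

theorem cosetPoly_monic (t : ZMod M) : (cosetPoly Q M η t).Monic := by
  obtain ⟨T, -, h⟩ := cosetPoly_eq_prod (Q := Q) (η := η) t
  rw [h]
  exact monic_prod_of_monic _ _ fun s _ => monic_X_sub_C _

theorem hatScale_cosetPoly_splits (t : ZMod M) {c : L} (hc : c ≠ 0) :
    (hatScale (cosetPoly Q M η t) c).Splits := by
  obtain ⟨T, -, h⟩ := cosetPoly_eq_prod (Q := Q) (η := η) t
  rw [h, hatScale_prod]
  refine Splits.prod fun s _ => ?_
  rw [hatScale_X_sub_C _ hc]
  exact Splits.X_sub_C _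

theorem eval_hatScale_cosetPoly (t : ZMod M) {c : L} (hc : c ≠ 0) (y : L) :
    (hatScale (cosetPoly Q M η t) c).eval y = 0 ↔
      ∃ j : ℕ, y = η ^ (t * (Q : ZMod M) ^ j).val * c⁻¹ := by
  obtain ⟨T, hT, h⟩ := cosetPoly_eq_prod (Q := Q) (η := η) t
  rw [h, hatScale_prod, eval_prod, Finset.prod_eq_zero_iff]
  constructor
  · rintro ⟨s, hs, h0⟩
    obtain ⟨j, rfl⟩ := (hT s).1 hs
    rw [hatScale_X_sub_C _ hc, eval_sub, eval_X, eval_C] at h0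
    exact ⟨j, sub_eq_zero.1 h0⟩
  · rintro ⟨j, rfl⟩
    refine ⟨_, (hT _).2 ⟨j, rfl⟩, ?_⟩
    rw [hatScale_X_sub_C _ hc, eval_sub, eval_X, eval_C, sub_self]

theorem cosetPoly_separable (hη : IsPrimitiveRoot η M) (t : ZMod M) :
    (cosetPoly Q M η t).Separable := by
  obtain ⟨T, -, h⟩ := cosetPoly_eq_prod (Q := Q) (η := η) t
  rw [h, separable_prod_X_sub_C_iff']
  exact fun s _ t _ h => pow_val_injective hη h

/-- Frobenius multiplies the exponents of η by q. -/
theorem map_cosetPoly (hη : η ^ M = 1) {q : ℕ} (hq : q.Coprime M) {σ : L →+* L}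
    (hσ : ∀ x, σ x = x ^ q) (t : ZMod M) :
    (cosetPoly Q M η t).map σ = cosetPoly Q M η (t * q) := by
  have hinj : Function.Injective fun s : ZMod M => s * (q : ZMod M) :=
    ((ZMod.isUnit_iff_coprime q M).2 hq).mul_left_injective
  rw [cosetPoly, cosetPoly, cyclotomicCoset_mul_natCast, finprod_mem_image hinj.injOn]
  have h := MonoidHom.map_finprod_mem (fun s : ZMod M => (X - C (η ^ s.val) : L[X]))
    (mapRingHom σ : L[X] →* L[X]) (Set.toFinite (cyclotomicCoset Q M t))
  refine Eq.trans h (finprod_congr fun s => finprod_congr fun _ => ?_)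
  simp [pow_val_mul_natCast hη, hσ, pow_right_comm]

theorem prod_X_sub_C_pow_val (hη : IsPrimitiveRoot η M) :
    ∏ s : ZMod M, (X - C (η ^ s.val)) = X ^ M - 1 := by
  rw [X_pow_sub_one_eq_prod (NeZero.pos M) hη]
  refine Finset.prod_nbij (fun s : ZMod M => η ^ s.val) (fun s _ => ?_)
    (fun s _ t _ h => pow_val_injective hη h) (fun ζ hζ => ?_) (fun _ _ => rfl)
  · rw [mem_nthRootsFinset (NeZero.pos M), ← pow_mul, mul_comm, pow_mul, hη.pow_eq_one, one_pow]
  · rw [Finset.mem_coe, mem_nthRootsFinset (NeZero.pos M)] at hζ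
    obtain ⟨i, hi, rfl⟩ := hη.eq_pow_of_pow_eq_one hζ
    exact ⟨i, by simp, by simp [ZMod.val_natCast_of_lt hi]⟩

theorem prod_cosetPoly (hη : IsPrimitiveRoot η M) (hQ : Q.Coprime M) {e : ℕ}
    {ρ : Fin (e + 1) → ZMod M} (hρ : IsCosetEnumeration Q M ρ) :
    ∏ i, cosetPoly Q M η (ρ i) = X ^ M - 1 := by
  rw [← prod_X_sub_C_pow_val hη, ← finprod_eq_prod_of_fintype, ← finprod_eq_prod_of_fintype,
    ← finprod_mem_univ fun s : ZMod M => X - C (η ^ s.val)]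
  have hU : (⋃ i, cyclotomicCoset Q M (ρ i)) = Set.univ := by
    refine Set.eq_univ_of_forall fun t => ?_
    obtain ⟨i, hi, -⟩ := hρ.2 t
    exact Set.mem_iUnion.2 ⟨i, (cyclotomicCoset_eq_iff hQ).1 hi⟩
  rw [← hU, finprod_mem_iUnion _ fun i => Set.toFinite _]
  · rfl
  · intro i j hij
    refine Set.disjoint_left.2 fun x hi hj => hij ?_
    obtain ⟨k, -, hk⟩ := hρ.2 x
    rw [hk i ((cyclotomicCoset_eq_iff hQ).2 hi), hk j ((cyclotomicCoset_eq_iff hQ).2 hj)]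

theorem cosetPoly_sq_mul (hQ : Q.Coprime M) {t : ZMod M}
    (h : ∀ j, Odd j → t * (Q : ZMod M) ^ j ≠ t) :
    cosetPoly (Q ^ 2) M η t * cosetPoly (Q ^ 2) M η (t * Q) = cosetPoly Q M η t := by
  rw [cosetPoly, cosetPoly, cosetPoly, ← cyclotomicCoset_sq_union (Q := Q) t,
    finprod_mem_union (disjoint_cyclotomicCoset_sq hQ h) (Set.toFinite _) (Set.toFinite _)]

/-- The coset polynomial is Frobenius-invariant, so it descends to F; its roots form one orbit, so
the descended polynomial is irreducible. -/
theorem map_rootMinpoly {F : Type*} [Field F] [Fintype F] [Algebra F L]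
    (hη : IsPrimitiveRoot η M) (hq : (Fintype.card F).Coprime M) (t : ZMod M) :
    (rootMinpoly F η t).map (algebraMap F L) = cosetPoly (Fintype.card F) M η t := by
  have hone : hatScale (cosetPoly (Fintype.card F) M η t) 1 =
      cosetPoly (Fintype.card F) M η t := by
    simp [hatScale, (cosetPoly_monic (Q := Fintype.card F) (η := η) t).leadingCoeff]
  have hev : ∀ y, (cosetPoly (Fintype.card F) M η t).eval y = 0 ↔
      ∃ j : ℕ, y = η ^ (t * (Fintype.card F : ZMod M) ^ j).val := fun y => by
    rw [← hone, eval_hatScale_cosetPoly t one_ne_zero]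
    simp
  obtain ⟨g, hg⟩ := exists_map_algebraMap_eq (F := F)
    (σ := (FiniteField.frobeniusAlgHom F L : L →+* L)) (fun x => rfl)
    (h := cosetPoly (Fintype.card F) M η t) (by
      rw [map_cosetPoly hη.pow_eq_one hq (fun x => rfl)]
      exact cosetPoly_congr (cyclotomicCoset_eq_of_mem hq ⟨1, by simp⟩))
  have hroot : aeval (η ^ t.val) g = 0 := by
    rw [← eval_map_algebraMap, hg, hev]
    exact ⟨0, by simp⟩
  have hirr : Irreducible g := by
    refine irreducible_of_roots_frobenius_orbit (x := η ^ t.val) ?_ ?_ hroot fun y hy => ?_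
    · rw [← separable_map (algebraMap F L), hg]
      exact cosetPoly_separable hη t
    · rw [hg, ← hone]
      exact hatScale_cosetPoly_splits t one_ne_zero
    · rw [← eval_map_algebraMap, hg, hev] at hy
      obtain ⟨j, rfl⟩ := hy
      exact ⟨j, by rw [← Nat.cast_pow, pow_val_mul_natCast hη.pow_eq_one]⟩
  rw [rootMinpoly, ← minpoly.eq_of_irreducible_of_monic hirr hroot, hg]
  exact monic_of_injective (algebraMap F L).injective (hg ▸ cosetPoly_monic t)

end CosetPoly

/-! ### Twisted coset polynomials. -/

section TwistedCosetPoly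

variable {L : Type*} [Field L] {q M : ℕ} {η : L}

/-- The polynomial whose roots are `η ^ s / c` with `s` in the `q ^ 2`-coset of `t` and
`-η ^ s / c` with `s` in the `q ^ 2`-coset of `t * q`. -/
noncomputable def twistedCosetPoly (r : ℕ) (η c : L) (t : ZMod M) : L[X] :=
  hatScale (cosetPoly (r ^ 2) M η t) c * hatScale (cosetPoly (r ^ 2) M η (t * r)) (-c)

theorem twistedCosetPoly_zero (r : ℕ) {c : L} (hc : c ≠ 0) :
    twistedCosetPoly r η c (0 : ZMod M) = (X - C c⁻¹) * (X + C c⁻¹) := by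
  rw [twistedCosetPoly, zero_mul, cosetPoly_zero, ← C_1, hatScale_X_sub_C _ hc,
    hatScale_X_sub_C _ (neg_ne_zero.2 hc)]
  simp [inv_neg]

theorem hatScale_X_pow_sub_one_mul_neg (hM : Odd M) {c : L} (hc : c ≠ 0) :
    hatScale (X ^ M - 1) c * hatScale (X ^ M - 1) (-c) = X ^ (2 * M) - C (c ^ (2 * M))⁻¹ := by
  rw [← C_1, hatScale_X_pow_sub_C hM.pos.ne' _ hc,
    hatScale_X_pow_sub_C hM.pos.ne' _ (neg_ne_zero.2 hc), hM.neg_pow, one_mul, one_mul, inv_neg,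
    mul_comm 2 M, pow_mul, pow_mul, ← inv_pow (c ^ M), C_neg, C_pow]
  ring

variable [NeZero M]

/-- As tq² and t share a q²-coset, the two factors use the same cosets with opposite signs. -/
theorem twistedCosetPoly_mul (hq : q.Coprime M) (c : L) {t : ZMod M}
    (h : ∀ j, Odd j → t * (q : ZMod M) ^ j ≠ t) :
    twistedCosetPoly q η c t * twistedCosetPoly q η c (t * (q : ZMod M)) =
      hatScale (cosetPoly q M η t) c * hatScale (cosetPoly q M η t) (-c) := by
  rw [← cosetPoly_sq_mul hq h, hatScale_mul, hatScale_mul, twistedCosetPoly, twistedCosetPoly,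
    cosetPoly_congr (cyclotomicCoset_sq_mul_mul hq t)]
  ring

theorem twistedCosetPoly_of_odd (hq : q.Coprime M) (c : L) {t : ZMod M} {j : ℕ} (hj : Odd j)
    (h : t * (q : ZMod M) ^ j = t) :
    twistedCosetPoly q η c t =
      hatScale (cosetPoly q M η t) c * hatScale (cosetPoly q M η t) (-c) := by
  obtain ⟨h1, h2⟩ := cyclotomicCoset_sq_of_odd hq hj h
  rw [twistedCosetPoly, cosetPoly_congr h1, cosetPoly_congr h2]

theorem prod_twistedCosetPoly_of_odd (hη : IsPrimitiveRoot η M) (hM : Odd M)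
    (hq : q.Coprime M) {c : L} (hc : c ≠ 0) {j : ℕ} (hj : Odd j)
    (h : (q : ZMod M) ^ j = 1) {e : ℕ} {ρ : Fin (e + 1) → ZMod M}
    (hρ : IsCosetEnumeration q M ρ) :
    ∏ i, twistedCosetPoly q η c (ρ i) = X ^ (2 * M) - C (c ^ (2 * M))⁻¹ := by
  simp_rw [fun i => twistedCosetPoly_of_odd (η := η) hq c hj
    (by rw [h, mul_one] : ρ i * (q : ZMod M) ^ j = ρ i)]
  rw [Finset.prod_mul_distrib, ← hatScale_prod, ← hatScale_prod, prod_cosetPoly hη hq hρ,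
    hatScale_X_pow_sub_one_mul_neg hM hc]

theorem prod_twistedCosetPoly_of_even (hη : IsPrimitiveRoot η M) (hM : Odd M)
    (hq : q.Coprime M) {c : L} (hc : c ≠ 0)
    (h : ∀ t : ZMod M, t ≠ 0 → ∀ j, Odd j → t * (q : ZMod M) ^ j ≠ t) {e : ℕ}
    {ρ : Fin (e + 1) → ZMod M} (hρ : IsCosetEnumeration q M ρ) :
    twistedCosetPoly q η c (0 : ZMod M) * ∏ i : Fin e, (twistedCosetPoly q η c (ρ i.succ) *
      twistedCosetPoly q η c (ρ i.succ * (q : ZMod M))) = X ^ (2 * M) - C (c ^ (2 * M))⁻¹ := by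
  -- The coset of 0 is listed only once, as `ρ 0`.
  have h0 : ∀ i : Fin e, ρ i.succ ≠ 0 := fun i hi => by
    obtain ⟨k, -, hk⟩ := hρ.2 0
    exact (Fin.succ_ne_zero i) ((hk i.succ (by simp only [hi])).trans (hk 0 (by simp only [hρ.1])).symm)
  simp_rw [fun i => twistedCosetPoly_mul (η := η) hq c (h _ (h0 i))]
  rw [← hatScale_X_pow_sub_one_mul_neg hM hc, ← prod_cosetPoly hη hq hρ, hatScale_prod,
    hatScale_prod, ← Finset.prod_mul_distrib, Fin.prod_univ_succ, hρ.1,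
    twistedCosetPoly_of_odd hq c odd_one (zero_mul _)]

variable {F : Type*} [Field F] [Fintype F] [Algebra F L]

/-- Frobenius interchanges the two factors: c becomes -c and t becomes tq. -/
theorem exists_map_eq_twistedCosetPoly (hη : η ^ M = 1) (hq : (Fintype.card F).Coprime M) {c : L}
    (hc : c ^ Fintype.card F = -c) (t : ZMod M) :
    ∃ g : F[X], g.map (algebraMap F L) = twistedCosetPoly (Fintype.card F) η c t := by
  have hσ : ∀ x, (FiniteField.frobeniusAlgHom F L : L →+* L) x = x ^ Fintype.card F := fun x => rfl
  refine exists_map_algebraMap_eq hσ ?_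
  rw [twistedCosetPoly, Polynomial.map_mul, map_hatScale, map_hatScale,
    map_cosetPoly hη hq hσ, map_cosetPoly hη hq hσ, map_neg, hσ, hc, neg_neg, mul_comm,
    cosetPoly_congr (cyclotomicCoset_sq_mul_mul hq t)]

theorem irreducible_of_map_eq_twistedCosetPoly (hη : η ^ M = 1) (hodd : Odd (Fintype.card F)) {c : L} (hc0 : c ≠ 0)
    (hc : c ^ Fintype.card F = -c) {t : ZMod M} {g : F[X]} (hs : g.Separable)
    (hg : g.map (algebraMap F L) = twistedCosetPoly (Fintype.card F) η c t) : Irreducible g := by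
  -- Even powers of Frobenius run through the roots of the first factor, odd powers through those of
  -- the second.
  have hx : ∀ j : ℕ, (η ^ t.val * c⁻¹) ^ Fintype.card F ^ j =
      η ^ (t * (Fintype.card F : ZMod M) ^ j).val * ((-1) ^ j * c⁻¹) := fun j => by
    have h : c ^ Fintype.card F ^ j = (-1) ^ j * c := by
      induction j with
      | zero => simp
      | succ j ih => rw [pow_succ, pow_mul, ih, mul_pow, hc, ← pow_mul, mul_comm j, pow_mul,
          hodd.neg_one_pow]; ring
    rw [mul_pow, inv_pow, h, ← Nat.cast_pow, pow_val_mul_natCast hη, mul_inv, ← inv_pow, inv_neg_one]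
  have hc0' : -c ≠ 0 := neg_ne_zero.2 hc0
  have hroot : ∀ y, aeval y g = 0 ↔ ∃ j : ℕ, y = (η ^ t.val * c⁻¹) ^ Fintype.card F ^ j := fun y => by
    rw [← eval_map_algebraMap, hg, twistedCosetPoly, eval_mul, mul_eq_zero,
      eval_hatScale_cosetPoly _ hc0, eval_hatScale_cosetPoly _ hc0']
    constructor
    · rintro (⟨j, rfl⟩ | ⟨j, rfl⟩)
      · refine ⟨2 * j, ?_⟩
        rw [hx, pow_mul (-1 : L), neg_one_sq, one_pow, one_mul]
        push_cast
        rw [pow_mul]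
      · refine ⟨2 * j + 1, ?_⟩
        rw [hx, pow_succ (-1 : L), pow_mul (-1 : L), neg_one_sq, one_pow, one_mul, neg_one_mul,
          inv_neg]
        push_cast
        rw [mul_assoc, ← pow_mul, ← pow_succ']
    · rintro ⟨j, rfl⟩
      rw [hx]
      rcases Nat.even_or_odd' j with ⟨k, rfl | rfl⟩
      · refine Or.inl ⟨k, ?_⟩
        rw [pow_mul (-1 : L), neg_one_sq, one_pow, one_mul]
        push_cast
        rw [pow_mul]
      · refine Or.inr ⟨k, ?_⟩
        rw [pow_succ (-1 : L), pow_mul (-1 : L), neg_one_sq, one_pow, one_mul, neg_one_mul,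
          inv_neg]
        push_cast
        rw [mul_assoc t, ← pow_mul, ← pow_succ']
  refine irreducible_of_roots_frobenius_orbit hs ?_ ((hroot _).2 ⟨0, by simp⟩)
    fun y hy => (hroot y).1 hy
  rw [hg, twistedCosetPoly]
  exact (hatScale_cosetPoly_splits _ hc0).mul (hatScale_cosetPoly_splits _ hc0')

end TwistedCosetPoly

/-! ### Parity of the order of q modulo ℓ. -/

section Arithmetic

/-- From q^f ≡ 1 mod ℓ, raising to the odd power ℓ^(m-1) gives a congruence mod ℓ^m. -/
theorem exists_odd_pow_eq_one {q ℓ m : ℕ} (hℓ : ℓ.Prime) (hℓ2 : ℓ ≠ 2) (hm : 0 < m)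
    (h : Odd (orderOf (q : ZMod ℓ))) : ∃ j, Odd j ∧ (q : ZMod (ℓ ^ m)) ^ j = 1 := by
  refine ⟨orderOf (q : ZMod ℓ) * ℓ ^ (m - 1), h.mul (hℓ.odd_of_ne_two hℓ2).pow, ?_⟩
  have h1 : ((ℓ : ℕ) : ℤ) ∣ (q : ℤ) ^ orderOf (q : ZMod ℓ) - 1 := by
    rw [← ZMod.intCast_zmod_eq_zero_iff_dvd]
    push_cast
    rw [pow_orderOf_eq_one, sub_self]
  have h2 := dvd_sub_pow_of_dvd_sub h1 (m - 1)
  rw [Nat.sub_add_cancel hm, one_pow, ← pow_mul] at h2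
  have h3 : (((ℓ ^ m : ℕ) : ℤ)) ∣ (q : ℤ) ^ (orderOf (q : ZMod ℓ) * ℓ ^ (m - 1)) - 1 := by
    exact_mod_cast h2
  rw [← ZMod.intCast_zmod_eq_zero_iff_dvd] at h3
  push_cast at h3
  exact sub_eq_zero.1 (by exact_mod_cast h3)

/-- An even order does not divide j, so q^j - 1 is prime to ℓ and invertible modulo ℓ^m. -/
theorem mul_pow_ne_self_of_even {q ℓ m : ℕ} (hℓ : ℓ.Prime) (h : Even (orderOf (q : ZMod ℓ)))
    {t : ZMod (ℓ ^ m)} (ht : t ≠ 0) {j : ℕ} (hj : Odd j) :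
    t * (q : ZMod (ℓ ^ m)) ^ j ≠ t := by
  intro heq
  have hq : (q : ZMod ℓ) ^ j ≠ 1 := fun h1 =>
    Nat.not_even_iff_odd.2 hj ((even_iff_two_dvd.1 h).trans (orderOf_dvd_of_pow_eq_one h1)
      |> even_iff_two_dvd.2)
  have hcop : IsCoprime ((q : ℤ) ^ j - 1) ((ℓ ^ m : ℕ) : ℤ) := by
    rw [Nat.cast_pow]
    refine IsCoprime.pow_right (IsCoprime.symm ?_)
    refine ((Nat.prime_iff_prime_int.1 hℓ).coprime_iff_not_dvd).2 fun hd => hq ?_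
    rw [← ZMod.intCast_zmod_eq_zero_iff_dvd] at hd
    push_cast at hd
    exact sub_eq_zero.1 hd
  obtain ⟨a, b, hab⟩ := hcop
  have h1 := congrArg (Int.cast : ℤ → ZMod (ℓ ^ m)) hab
  have h0 : ((ℓ : ZMod (ℓ ^ m))) ^ m = 0 := by
    rw [← Nat.cast_pow, ZMod.natCast_self]
  push_cast at h1
  rw [h0, mul_zero, add_zero] at h1
  refine ht ?_
  linear_combination (-t) * h1 + (a : ZMod (ℓ ^ m)) * heq

end Arithmetic

/-! ### Choice of the scalars a, b, α₁ and β₁. -/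

section Scalars

variable {F : Type*} [Field F]

theorem mul_inv_mem_zpowers_sq {ξ x : Fˣ} (hξ : ∀ x : Fˣ, x ∈ Subgroup.zpowers ξ) {k : ℕ}
    (hk : Odd k) (hx : x ∉ Subgroup.zpowers (ξ ^ 2)) :
    ξ ^ k * x⁻¹ ∈ Subgroup.zpowers (ξ ^ 2) := by
  obtain ⟨j, rfl⟩ := Subgroup.mem_zpowers_iff.1 (hξ x)
  have hmem : ∀ i : ℤ, Even i → ξ ^ i ∈ Subgroup.zpowers (ξ ^ 2) := by
    rintro _ ⟨i, rfl⟩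
    refine Subgroup.mem_zpowers_iff.2 ⟨i, ?_⟩
    rw [← zpow_natCast, ← zpow_mul]
    congr 1
    push_cast
    ring
  have hj : Odd j := Int.not_even_iff_odd.1 fun h => hx (hmem j h)
  rw [← zpow_natCast ξ k, ← zpow_neg, ← zpow_add]
  refine hmem _ ?_
  rw [← sub_eq_add_neg]
  exact Odd.sub_odd (by exact_mod_cast hk) hj

variable [Fintype F]

theorem exists_pow_eq_of_coprime {k : ℕ} (hk : (Fintype.card F - 1).Coprime k) (x : Fˣ) :
    ∃ a : Fˣ, a ^ k = x := by
  classical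
  have h : (Nat.card Fˣ).Coprime k := by
    rwa [Nat.card_eq_fintype_card, Fintype.card_units]
  exact ⟨(powCoprime h).symm x, (powCoprime h).apply_symm_apply x⟩

/-- The part of the exponent coprime to q - 1 acts bijectively on Fˣ; only the factor 2 needs x to
be a square. -/
theorem exists_pow_two_mul_eq {ℓ m p n : ℕ} (h : (Fintype.card F - 1).Coprime (ℓ ^ m * p ^ n))
    {ξ x : Fˣ} (hx : x ∈ Subgroup.zpowers (ξ ^ 2)) :
    ∃ a : Fˣ, a ^ (2 * ℓ ^ m * p ^ n) = x := by
  obtain ⟨k, rfl⟩ := Subgroup.mem_zpowers_iff.1 hx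
  obtain ⟨a, ha⟩ := exists_pow_eq_of_coprime h (ξ ^ k)
  refine ⟨a, ?_⟩
  rw [mul_assoc, mul_comm, pow_mul, ha, ← zpow_natCast, ← zpow_natCast, ← zpow_mul, ← zpow_mul,
    mul_comm]

theorem orderOf_eq_card_sub_one {ξ : Fˣ} (hξ : ∀ x : Fˣ, x ∈ Subgroup.zpowers ξ) :
    orderOf ξ = Fintype.card F - 1 := by
  classical
  rw [orderOf_eq_card_of_forall_mem_zpowers hξ, Nat.card_eq_fintype_card, Fintype.card_units]

variable {K : Type*} [Field K] [Algebra F K]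

theorem exists_sq_eq_algebraMap (hF : ringChar F ≠ 2) (hK : Module.finrank F K = 2) (x : Fˣ) :
    ∃ α : K, α ^ 2 = algebraMap F K x := by
  classical
  have hfin : Module.Finite F K := Module.finite_of_finrank_eq_succ hK
  have : Finite K := Module.finite_of_finite F
  let : Fintype K := Fintype.ofFinite K
  have hcard : Fintype.card K = Fintype.card F ^ 2 := by
    rw [Module.card_eq_pow_finrank (K := F), hK]
  have hodd : Fintype.card F % 2 = 1 := FiniteField.odd_card_of_char_ne_two hF
  have hKc : ringChar K ≠ 2 := by
    rwa [← Algebra.ringChar_eq F K]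
  have hsq : IsSquare (algebraMap F K x) := by
    rw [FiniteField.isSquare_iff hKc (by simp), hcard]
    -- Euler's criterion in K: the floor of q²/2 is (q² - 1)/2, a multiple of q - 1.
    have h : Fintype.card F ^ 2 / 2 = (Fintype.card F - 1) * ((Fintype.card F + 1) / 2) := by
      obtain ⟨k, hk⟩ : ∃ k, Fintype.card F = 2 * k + 1 := ⟨_, (Nat.two_mul_div_two_add_one_of_odd
        (Nat.odd_iff.2 hodd)).symm⟩
      rw [hk, show (2 * k + 1) ^ 2 = 2 * (2 * k * (k + 1)) + 1 by ring, Nat.add_sub_cancel,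
        show 2 * k + 1 + 1 = 2 * (k + 1) by ring, Nat.mul_div_cancel_left _ two_pos]
      omega
    rw [h, pow_mul, ← map_pow, FiniteField.pow_card_sub_one_eq_one _ x.ne_zero, map_one, one_pow]
  obtain ⟨α, hα⟩ := hsq
  exact ⟨α, by rw [hα, sq]⟩

theorem isPrimitiveRoot_of_sq_eq {ξ : Fˣ} (hξ : ∀ x : Fˣ, x ∈ Subgroup.zpowers ξ)
    (hq : Odd (Fintype.card F)) {α : K} (hα : α ^ 2 = algebraMap F K ξ) :
    IsPrimitiveRoot α (2 * (Fintype.card F - 1)) := by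
  have hone : ∀ k, α ^ (2 * k) = 1 ↔ Fintype.card F - 1 ∣ k := fun k => by
    rw [← orderOf_eq_card_sub_one hξ, orderOf_dvd_iff_pow_eq_one, pow_mul, hα, ← map_pow,
      map_eq_one_iff _ (algebraMap F K).injective, Units.ext_iff]
    simp
  refine ⟨(hone _).2 dvd_rfl, fun k hk => ?_⟩
  have h2 : 2 ∣ Fintype.card F - 1 := by
    obtain ⟨i, hi⟩ := hq
    exact ⟨i, by omega⟩
  -- From α^k = 1 follows q - 1 ∣ k, so k is even and `hone` applies to its half.
  obtain ⟨i, rfl⟩ := h2.trans ((hone k).1 (by rw [mul_comm, pow_mul, hk, one_pow]))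
  exact mul_dvd_mul_left 2 ((hone i).1 hk)

theorem existsUnique_primitiveRoot_pow_mul_eq_one {M N : ℕ} (hN : 0 < N) (hMN : M.Coprime N)
    {α : K} (hα : IsPrimitiveRoot α N) :
    ∃! β : K, IsPrimitiveRoot β N ∧ β ^ M * α = 1 := by
  -- The exponent u inverts M on the powers of α, so β = α^(-u). For uniqueness, βα^u has order
  -- dividing both M and N.
  obtain ⟨u, hu⟩ := exists_pow_eq_self_of_coprime (x := α) (n := M) (hα.eq_orderOf ▸ hMN)
  rw [← pow_mul] at hu
  have hroot : IsPrimitiveRoot (α ^ u) N := by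
    refine ⟨by rw [← pow_mul, mul_comm, pow_mul, hα.pow_eq_one, one_pow], fun k hk => ?_⟩
    refine hα.dvd_of_pow_eq_one k ?_
    rw [← hu, ← pow_mul, mul_comm M u, mul_assoc, mul_comm M k, pow_mul, pow_mul, hk, one_pow]
  have hα0 : α ≠ 0 := hα.ne_zero hN.ne'
  have hβ : (α ^ u)⁻¹ ^ M * α = 1 := by
    rw [inv_pow, ← pow_mul, mul_comm u, hu, inv_mul_cancel₀ hα0]
  refine ⟨(α ^ u)⁻¹, ⟨hroot.inv, hβ⟩, fun β ⟨h1, h2⟩ => ?_⟩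
  have hM : (β * α ^ u) ^ M = 1 := by
    rw [mul_pow, ← h2, ← pow_mul α u M, mul_comm u, hu]
  have hN' : (β * α ^ u) ^ N = 1 := by
    rw [mul_pow, h1.pow_eq_one, hroot.pow_eq_one, one_mul]
  have h1 : orderOf (β * α ^ u) = 1 := Nat.eq_one_of_dvd_coprimes hMN
    (orderOf_dvd_of_pow_eq_one hM) (orderOf_dvd_of_pow_eq_one hN')
  exact eq_inv_of_mul_eq_one_left (orderOf_eq_one_iff.1 h1)

theorem IsPrimitiveRoot.pow_succ_half_eq_neg {k : ℕ} (hk : 0 < k) {β : K}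
    (hβ : IsPrimitiveRoot β (2 * k)) : β ^ (k + 1) = -β := by
  have h2 : IsPrimitiveRoot (β ^ k) 2 := hβ.pow (by omega) (mul_comm 2 k)
  rw [pow_succ, h2.eq_neg_one_of_two_right, neg_one_mul]

end Scalars

/-! ### Exponent vectors for paired factors. -/

section SplitExponents

variable {F : Type*} [Field F] (p : ℕ) [Fact p.Prime] [CharP F p] {n k : ℕ}

theorem isConstacyclic_iff_existsUnique_pair {κ : Type*} [Fintype κ] (hk : (k : F) ≠ 0)
    {μ lam : F} (hμ : μ ≠ 0) (hμl : μ ^ p ^ n = lam) {A B : κ → F[X]}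
    (hA : ∀ i, Irreducible (A i)) (hAm : ∀ i, (A i).Monic)
    (hB : ∀ i, Irreducible (B i)) (hBm : ∀ i, (B i).Monic)
    (hprod : ∏ i, A i * B i = X ^ k - C μ) :
    X ^ (k * p ^ n) - C lam = ∏ i, A i ^ p ^ n * B i ^ p ^ n ∧
    ∀ D : Submodule F (Fin (k * p ^ n) → F), IsConstacyclic lam D ↔
      ∃! ε : (κ → ℕ) × (κ → ℕ), (∀ i, ε.1 i ≤ p ^ n ∧ ε.2 i ≤ p ^ n) ∧
        IsGeneratorPoly lam D (∏ i, A i ^ ε.1 i * B i ^ ε.2 i) := by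
  obtain ⟨h1, h2⟩ := isConstacyclic_iff_existsUnique p (n := n) hk hμ hμl (G := Sum.elim A B)
    (Sum.forall.2 ⟨hA, hB⟩) (Sum.forall.2 ⟨hAm, hBm⟩)
    (by simpa [Fintype.prod_sum_type, Finset.prod_mul_distrib] using hprod)
  refine ⟨by simpa [Fintype.prod_sum_type, Finset.prod_mul_distrib] using h1, fun D => ?_⟩
  rw [h2 D]
  refine (Equiv.sumArrowEquivProdArrow κ κ ℕ).existsUnique_congr fun ε => ?_
  simp [Sum.forall, forall_and, Fintype.prod_sum_type, Finset.prod_mul_distrib]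

theorem isConstacyclic_iff_existsUnique_triple {κ : Type*} [Fintype κ] (hk : (k : F) ≠ 0)
    {μ lam : F} (hμ : μ ≠ 0) (hμl : μ ^ p ^ n = lam) {P : F[X]} {A B : κ → F[X]}
    (hP : Irreducible P) (hPm : P.Monic)
    (hA : ∀ i, Irreducible (A i)) (hAm : ∀ i, (A i).Monic)
    (hB : ∀ i, Irreducible (B i)) (hBm : ∀ i, (B i).Monic)
    (hprod : P * ∏ i, A i * B i = X ^ k - C μ) :
    X ^ (k * p ^ n) - C lam = P ^ p ^ n * ∏ i, A i ^ p ^ n * B i ^ p ^ n ∧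
    ∀ D : Submodule F (Fin (k * p ^ n) → F), IsConstacyclic lam D ↔
      ∃! ε : ℕ × (κ → ℕ) × (κ → ℕ),
        ε.1 ≤ p ^ n ∧ (∀ i, ε.2.1 i ≤ p ^ n ∧ ε.2.2 i ≤ p ^ n) ∧
        IsGeneratorPoly lam D (P ^ ε.1 * ∏ i, A i ^ ε.2.1 i * B i ^ ε.2.2 i) := by
  obtain ⟨h1, h2⟩ := isConstacyclic_iff_existsUnique p (n := n) hk hμ hμl
    (G := Sum.elim (fun _ : Unit => P) (Sum.elim A B))
    (Sum.forall.2 ⟨fun _ => hP, Sum.forall.2 ⟨hA, hB⟩⟩)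
    (Sum.forall.2 ⟨fun _ => hPm, Sum.forall.2 ⟨hAm, hBm⟩⟩)
    (by simpa [Fintype.prod_sum_type, Finset.prod_mul_distrib] using hprod)
  refine ⟨by simpa [Fintype.prod_sum_type, Finset.prod_mul_distrib] using h1, fun D => ?_⟩
  rw [h2 D]
  refine ((Equiv.sumArrowEquivProdArrow Unit (κ ⊕ κ) ℕ).trans
    ((Equiv.funUnique Unit ℕ).prodCongr
      (Equiv.sumArrowEquivProdArrow κ κ ℕ))).existsUnique_congr fun ε => ?_
  simp [Sum.forall, forall_and, Fintype.prod_sum_type, Finset.prod_mul_distrib, and_assoc]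
  exact fun _ _ _ => ⟨fun h => h (), fun h _ => h⟩

end SplitExponents

/-! ### Irreducible factors over F. -/

section Factorization

variable {F L : Type*} [Field F] [Field L] [Algebra F L] {M : ℕ} [NeZero M] {η : L}

theorem rootMinpoly_irreducible (hη : IsPrimitiveRoot η M) (t : ZMod M) :
    Irreducible (rootMinpoly F η t) :=
  minpoly.irreducible (((hη.isIntegral (NeZero.pos M)).tower_top (A := F)).pow _)

variable [Fintype F]

theorem prod_rootMinpoly (hη : IsPrimitiveRoot η M) (hq : (Fintype.card F).Coprime M) {e : ℕ}
    {ρ : Fin (e + 1) → ZMod M} (hρ : IsCosetEnumeration (Fintype.card F) M ρ) :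
    ∏ i, rootMinpoly F η (ρ i) = X ^ M - 1 := by
  apply map_injective (algebraMap F L) (algebraMap F L).injective
  rw [Polynomial.map_prod]
  simp_rw [map_rootMinpoly hη hq]
  rw [prod_cosetPoly hη hq hρ]
  simp

/-- If the polynomials `g i` over `F` are twisted coset polynomials over `L` whose product is
`X ^ (2 * M) - x`, then they are irreducible. -/
theorem irreducible_of_prod_twistedCosetPoly {ι : Type*} [Fintype ι] (hη : η ^ M = 1)
    (hodd : Odd (Fintype.card F)) (hM : ((2 * M : ℕ) : F) ≠ 0) {c : L} (hc0 : c ≠ 0)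
    (hc : c ^ Fintype.card F = -c) {x : F} (hx : x ≠ 0) {g : ι → F[X]} {t : ι → ZMod M}
    (hg : ∀ i, (g i).map (algebraMap F L) = twistedCosetPoly (Fintype.card F) η c (t i))
    (hprod : ∏ i, g i = X ^ (2 * M) - C x) (i : ι) : Irreducible (g i) :=
  irreducible_of_map_eq_twistedCosetPoly hη hodd hc0 hc
    ((separable_X_pow_sub_C x hM hx).of_dvd (hprod ▸ Finset.dvd_prod_of_mem g (Finset.mem_univ i)))
    (hg i)

end Factorization

/-! ### Assembly of the cases. -/

theorem mainTheorem1 {F K L : Type*} [Field F] [Fintype F] [Field K] [Field L]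
    [Algebra F K] [Algebra F L] [Algebra K L] [IsScalarTower F K L]
    (p q ℓ m n : ℕ) (hp : p.Prime) (hp2 : p ≠ 2) [CharP F p] (hq : Fintype.card F = q)
    (hK : Module.finrank F K = 2)
    (hℓ : ℓ.Prime) (hℓ2 : ℓ ≠ 2) (hℓp : ℓ ≠ p) (hm : 0 < m) (hgcd : Nat.gcd ℓ (q - 1) = 1)
    (ξ : Fˣ) (hξ : ∀ x : Fˣ, x ∈ Subgroup.zpowers ξ)
    (η : L) (hη : IsPrimitiveRoot η (ℓ ^ m))
    (e : ℕ) (ρ : Fin (e + 1) → ZMod (ℓ ^ m)) (hρ : IsCosetEnumeration q (ℓ ^ m) ρ)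
    (lam : Fˣ) :
    -- Case (A)
    (lam ∈ Subgroup.zpowers (ξ ^ 2) →
      (∃ a : Fˣ, a ^ (2 * ℓ ^ m * p ^ n) * lam = 1) ∧
      ∀ a : Fˣ, a ^ (2 * ℓ ^ m * p ^ n) * lam = 1 →
        (X ^ (2 * ℓ ^ m * p ^ n) - C (lam : F) =
          ∏ i, hatScale (rootMinpoly F η (ρ i)) (a : F) ^ p ^ n *
            hatScale (rootMinpoly F η (ρ i)) (-a : F) ^ p ^ n) ∧
        (∀ i, Irreducible (hatScale (rootMinpoly F η (ρ i)) (a : F)) ∧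
          Irreducible (hatScale (rootMinpoly F η (ρ i)) (-a : F))) ∧
        ∀ D : Submodule F (Fin (2 * ℓ ^ m * p ^ n) → F), IsConstacyclic (lam : F) D ↔
          ∃! ε : (Fin (e + 1) → ℕ) × (Fin (e + 1) → ℕ),
            (∀ i, ε.1 i ≤ p ^ n ∧ ε.2 i ≤ p ^ n) ∧
            IsGeneratorPoly (lam : F) D
              (∏ i, hatScale (rootMinpoly F η (ρ i)) (a : F) ^ ε.1 i *
                hatScale (rootMinpoly F η (ρ i)) (-a : F) ^ ε.2 i)) ∧
    -- Case (B)
    (lam ∉ Subgroup.zpowers (ξ ^ 2) →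
      (∃ b : Fˣ, b ^ (2 * ℓ ^ m * p ^ n) * lam = ξ ^ p ^ n) ∧
      (∃ α₁ : K, α₁ ^ 2 = algebraMap F K ξ) ∧
      ∀ α₁ : K, α₁ ^ 2 = algebraMap F K ξ →
        (∃! β₁ : K, IsPrimitiveRoot β₁ (2 * (q - 1)) ∧ β₁ ^ ℓ ^ m * α₁ = 1) ∧
        ∀ β₁ : K, IsPrimitiveRoot β₁ (2 * (q - 1)) → β₁ ^ ℓ ^ m * α₁ = 1 →
          β₁ ^ q = -β₁ ∧
          ∀ b : Fˣ, b ^ (2 * ℓ ^ m * p ^ n) * lam = ξ ^ p ^ n →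
            -- Case (B1)
            (Odd (orderOf (q : ZMod ℓ)) →
              ∃ S : Fin (e + 1) → F[X],
                (∀ i, (S i).map (algebraMap F K) =
                  hatScale ((rootMinpoly F η (ρ i)).map (algebraMap F K)) β₁ *
                    hatScale ((rootMinpoly F η (ρ i)).map (algebraMap F K)) (-β₁)) ∧
                (X ^ (2 * ℓ ^ m * p ^ n) - C (lam : F) =
                  ∏ i, hatScale (S i) (b : F) ^ p ^ n) ∧
                (∀ i, Irreducible (hatScale (S i) (b : F))) ∧
                ∀ D : Submodule F (Fin (2 * ℓ ^ m * p ^ n) → F), IsConstacyclic (lam : F) D ↔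
                  ∃! ε : Fin (e + 1) → ℕ,
                    (∀ i, ε i ≤ p ^ n) ∧
                    IsGeneratorPoly (lam : F) D (∏ i, hatScale (S i) (b : F) ^ ε i)) ∧
            -- Case (B2)
            (Even (orderOf (q : ZMod ℓ)) →
              ∃ (P : F[X]) (Q R : Fin e → F[X]),
                (P.map (algebraMap F K) = (X - C β₁⁻¹) * (X + C β₁⁻¹)) ∧
                (∀ i : Fin e, (Q i).map (algebraMap F L) =
                  hatScale (cosetPoly (q ^ 2) (ℓ ^ m) η (ρ i.succ)) (algebraMap K L β₁) *
                    hatScale (cosetPoly (q ^ 2) (ℓ ^ m) η (ρ i.succ * (q : ZMod (ℓ ^ m))))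
                      (-algebraMap K L β₁)) ∧
                (∀ i : Fin e, (R i).map (algebraMap F L) =
                  hatScale (cosetPoly (q ^ 2) (ℓ ^ m) η (ρ i.succ * (q : ZMod (ℓ ^ m))))
                      (algebraMap K L β₁) *
                    hatScale (cosetPoly (q ^ 2) (ℓ ^ m) η (ρ i.succ)) (-algebraMap K L β₁)) ∧
                (X ^ (2 * ℓ ^ m * p ^ n) - C (lam : F) =
                  hatScale P (b : F) ^ p ^ n *
                    ∏ i, hatScale (Q i) (b : F) ^ p ^ n * hatScale (R i) (b : F) ^ p ^ n) ∧
                Irreducible (hatScale P (b : F)) ∧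
                (∀ i, Irreducible (hatScale (Q i) (b : F)) ∧
                  Irreducible (hatScale (R i) (b : F))) ∧
                ∀ D : Submodule F (Fin (2 * ℓ ^ m * p ^ n) → F), IsConstacyclic (lam : F) D ↔
                  ∃! ε : ℕ × (Fin e → ℕ) × (Fin e → ℕ),
                    ε.1 ≤ p ^ n ∧ (∀ i, ε.2.1 i ≤ p ^ n ∧ ε.2.2 i ≤ p ^ n) ∧
                    IsGeneratorPoly (lam : F) D
                      (hatScale P (b : F) ^ ε.1 *
                        ∏ i, hatScale (Q i) (b : F) ^ ε.2.1 i *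
                          hatScale (R i) (b : F) ^ ε.2.2 i))) := by
  subst hq
  have : Fact p.Prime := ⟨hp⟩
  have : NeZero (ℓ ^ m) := ⟨pow_ne_zero m hℓ.ne_zero⟩
  have hpq : p ∣ Fintype.card F := by
    rw [← CharP.cast_eq_zero_iff F p]
    exact FiniteField.cast_card_eq_zero F
  have hchar : ringChar F ≠ 2 := by rwa [ringChar.eq F p]
  have hodd : Odd (Fintype.card F) := Nat.odd_iff.2 (FiniteField.odd_card_of_char_ne_two hchar)
  have hq1 : 1 < Fintype.card F := Fintype.one_lt_card
  have hMo : Odd (ℓ ^ m) := (hℓ.odd_of_ne_two hℓ2).pow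
  have hqM : (Fintype.card F).Coprime (ℓ ^ m) := by
    obtain ⟨k, -, hk⟩ := FiniteField.card F p
    rw [hk]
    exact Nat.Coprime.pow _ _ ((Nat.coprime_primes hp hℓ).2 hℓp.symm)
  have hM2 : (ℓ ^ m).Coprime (Fintype.card F - 1) := Nat.Coprime.pow_left m hgcd
  have hMp : (Fintype.card F - 1).Coprime (ℓ ^ m * p ^ n) := by
    refine Nat.Coprime.mul_right hM2.symm (Nat.Coprime.pow_right n ?_)
    -- As p divides q, dividing q - 1 too would make it divide 1.
    refine ((hp.coprime_iff_not_dvd).2 fun h => hp.one_lt.ne' ?_).symm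
    refine Nat.dvd_one.1 ((Nat.dvd_sub_iff_right hq1.le hpq).1 ?_ )
    simpa using h
  have hk0 : ((2 * ℓ ^ m : ℕ) : F) ≠ 0 := by
    rw [Ne, CharP.cast_eq_zero_iff F p, hp.dvd_mul, Nat.prime_dvd_prime_iff_eq hp Nat.prime_two]
    rintro (h | h)
    · exact hp2 h
    · exact hℓp ((Nat.prime_dvd_prime_iff_eq hp hℓ).1 (hp.dvd_of_dvd_pow h)).symm
  refine ⟨fun hlam => ⟨?_, fun a ha => ?_⟩, fun hlam => ⟨?_, exists_sq_eq_algebraMap hchar hK ξ,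
    fun α hα => ⟨?_, fun β hβ hβα => ?_⟩⟩⟩
  · obtain ⟨a, ha⟩ := exists_pow_two_mul_eq hMp (Subgroup.inv_mem _ hlam)
    exact ⟨a, by rw [ha, inv_mul_cancel]⟩
  · have hirr := fun (c : F) (hc : c ≠ 0) i =>
      hatScale_irreducible (rootMinpoly_irreducible (F := F) hη (ρ i)) hc
    have hmon := fun (c : F) (hc : c ≠ 0) i =>
      hatScale_monic (rootMinpoly_irreducible (F := F) hη (ρ i)).ne_zero hc
    have hna : (-a : F) ≠ 0 := neg_ne_zero.2 a.ne_zero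
    have hμ : ((a : F) ^ (2 * ℓ ^ m))⁻¹ ^ p ^ n = lam := by
      rw [inv_pow, ← pow_mul]
      exact inv_eq_of_mul_eq_one_right (by simpa using congrArg Units.val ha)
    obtain ⟨h1, h2⟩ := isConstacyclic_iff_existsUnique_pair p (n := n) hk0
      (inv_ne_zero (pow_ne_zero _ a.ne_zero)) hμ (hirr a a.ne_zero) (hmon a a.ne_zero)
      (hirr (-a) hna) (hmon (-a) hna) (by
        rw [Finset.prod_mul_distrib, ← hatScale_prod, ← hatScale_prod,
          prod_rootMinpoly hη hqM hρ, hatScale_X_pow_sub_one_mul_neg hMo a.ne_zero])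
    exact ⟨h1, fun i => ⟨hirr a a.ne_zero i, hirr (-a) hna i⟩, h2⟩
  · obtain ⟨b, hb⟩ := exists_pow_two_mul_eq hMp
      (mul_inv_mem_zpowers_sq hξ (hp.odd_of_ne_two hp2).pow hlam)
    exact ⟨b, by rw [hb, inv_mul_cancel_right]⟩
  · refine existsUnique_primitiveRoot_pow_mul_eq_one (by omega) ?_
      (isPrimitiveRoot_of_sq_eq hξ hodd hα)
    exact Nat.Coprime.mul_right (Nat.coprime_two_right.2 hMo) hM2
  have hβq : β ^ Fintype.card F = -β := by
    have h := hβ.pow_succ_half_eq_neg (by omega)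
    rwa [Nat.sub_add_cancel hq1.le] at h
  refine ⟨hβq, fun b hb => ?_⟩
  have hβ0 : β ≠ 0 := hβ.ne_zero (by omega)
  have hc0 : algebraMap K L β ≠ 0 := (_root_.map_ne_zero _).2 hβ0
  have hcq : algebraMap K L β ^ Fintype.card F = -algebraMap K L β := by
    rw [← map_pow, hβq, map_neg]
  have hcξ : (algebraMap K L β ^ (2 * ℓ ^ m))⁻¹ = algebraMap F L ξ := by
    rw [IsScalarTower.algebraMap_apply F K L, ← hα, ← map_pow, ← map_inv₀]
    congr 1
    refine inv_eq_of_mul_eq_one_right ?_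
    rw [mul_comm 2, pow_mul, ← mul_pow, hβα, one_pow]
  have hb0 : (b : F) ^ (2 * ℓ ^ m) ≠ 0 := pow_ne_zero _ b.ne_zero
  have hμ0 : (ξ : F) * ((b : F) ^ (2 * ℓ ^ m))⁻¹ ≠ 0 := mul_ne_zero ξ.ne_zero (inv_ne_zero hb0)
  -- This is why b is normalised by ξ^(p^n) and not by ξ.
  have hμ : ((ξ : F) * ((b : F) ^ (2 * ℓ ^ m))⁻¹) ^ p ^ n = lam := by
    have h := congrArg Units.val hb
    push_cast at h
    rw [mul_pow, ← h, inv_pow, ← pow_mul, mul_comm, inv_mul_cancel_left₀ (pow_ne_zero _ b.ne_zero)]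
  have hscale : hatScale (X ^ (2 * ℓ ^ m) - C (ξ : F)) (b : F) =
      X ^ (2 * ℓ ^ m) - C ((ξ : F) * ((b : F) ^ (2 * ℓ ^ m))⁻¹) :=
    hatScale_X_pow_sub_C (mul_ne_zero two_ne_zero (NeZero.ne _)) _ b.ne_zero
  choose g hg using exists_map_eq_twistedCosetPoly (F := F) hη.pow_eq_one hqM hcq
  have hinj : Function.Injective (Polynomial.map (algebraMap F L)) :=
    map_injective _ (algebraMap F L).injective
  have hmapξ : (X ^ (2 * ℓ ^ m) - C (ξ : F)).map (algebraMap F L) =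
      X ^ (2 * ℓ ^ m) - C (algebraMap K L β ^ (2 * ℓ ^ m))⁻¹ := by
    rw [hcξ]
    simp
  refine ⟨fun hf => ?_, fun hf => ?_⟩
  · obtain ⟨j, hj, hqj⟩ := exists_odd_pow_eq_one hℓ hℓ2 hm hf
    have hprod : ∏ i, g (ρ i) = X ^ (2 * ℓ ^ m) - C (ξ : F) := hinj <| by
      rw [Polynomial.map_prod, hmapξ]
      simp_rw [hg]
      exact prod_twistedCosetPoly_of_odd hη hMo hqM hc0 hj hqj hρ
    have hirr : ∀ i, Irreducible (g (ρ i)) :=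
      irreducible_of_prod_twistedCosetPoly hη.pow_eq_one hodd hk0 hc0 hcq ξ.ne_zero
        (fun i => hg (ρ i)) hprod
    obtain ⟨h1, h2⟩ := isConstacyclic_iff_existsUnique p (n := n) hk0 hμ0 hμ
      (fun i => hatScale_irreducible (hirr i) b.ne_zero)
      (fun i => hatScale_monic (hirr i).ne_zero b.ne_zero)
      (by rw [← hatScale_prod, hprod, hscale])
    refine ⟨fun i => g (ρ i), fun i => ?_, h1,
      fun i => hatScale_irreducible (hirr i) b.ne_zero, h2⟩
    -- The identity over K is checked in L, where η lives.
    apply map_injective (algebraMap K L) (algebraMap K L).injective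
    rw [Polynomial.map_map, ← IsScalarTower.algebraMap_eq, hg, Polynomial.map_mul,
      map_hatScale, map_hatScale, Polynomial.map_map, ← IsScalarTower.algebraMap_eq,
      map_rootMinpoly hη hqM, map_neg]
    exact twistedCosetPoly_of_odd hqM _ hj (by rw [hqj, mul_one])
  · have hprod : g 0 * ∏ i : Fin e, g (ρ i.succ) * g (ρ i.succ * (Fintype.card F : ZMod (ℓ ^ m))) =
        X ^ (2 * ℓ ^ m) - C (ξ : F) := hinj <| by
      rw [Polynomial.map_mul, Polynomial.map_prod, hmapξ]
      simp_rw [Polynomial.map_mul, hg]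
      exact prod_twistedCosetPoly_of_even hη hMo hqM hc0
        (fun t ht j hj => mul_pow_ne_self_of_even hℓ hf ht hj) hρ
    -- All factors are treated as one family, since separability is inherited from their product.
    have hirr := irreducible_of_prod_twistedCosetPoly hη.pow_eq_one hodd hk0 hc0 hcq ξ.ne_zero
      (g := Sum.elim (fun _ : Unit => g 0) (Sum.elim (fun i : Fin e => g (ρ i.succ))
        fun i : Fin e => g (ρ i.succ * (Fintype.card F : ZMod (ℓ ^ m)))))
      (t := Sum.elim (fun _ : Unit => 0) (Sum.elim (fun i : Fin e => ρ i.succ)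
        fun i : Fin e => ρ i.succ * (Fintype.card F : ZMod (ℓ ^ m))))
      (by rintro (i | i | i) <;> exact hg _)
      (by simpa [Fintype.prod_sum_type, Finset.prod_mul_distrib] using hprod)
    have hP : Irreducible (g 0) := hirr (Sum.inl ())
    have hQ : ∀ i : Fin e, Irreducible (g (ρ i.succ)) := fun i => hirr (Sum.inr (Sum.inl i))
    have hR : ∀ i : Fin e, Irreducible (g (ρ i.succ * (Fintype.card F : ZMod (ℓ ^ m)))) :=
      fun i => hirr (Sum.inr (Sum.inr i))
    obtain ⟨h1, h2⟩ := isConstacyclic_iff_existsUnique_triple p (n := n) hk0 hμ0 hμ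
      (hatScale_irreducible hP b.ne_zero) (hatScale_monic hP.ne_zero b.ne_zero)
      (fun i => hatScale_irreducible (hQ i) b.ne_zero)
      (fun i => hatScale_monic (hQ i).ne_zero b.ne_zero)
      (fun i => hatScale_irreducible (hR i) b.ne_zero)
      (fun i => hatScale_monic (hR i).ne_zero b.ne_zero)
      (by
        simp_rw [← hatScale_mul]
        rw [← hatScale_prod, ← hatScale_mul, hprod, hscale])
    refine ⟨g 0, fun i => g (ρ i.succ),
      fun i => g (ρ i.succ * (Fintype.card F : ZMod (ℓ ^ m))), ?_, fun i => hg _, fun i => ?_, h1,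
      hatScale_irreducible hP b.ne_zero, fun i => ⟨hatScale_irreducible (hQ i) b.ne_zero,
        hatScale_irreducible (hR i) b.ne_zero⟩, h2⟩
    · apply map_injective (algebraMap K L) (algebraMap K L).injective
      rw [Polynomial.map_map, ← IsScalarTower.algebraMap_eq, hg, twistedCosetPoly_zero _ hc0]
      simp
    · rw [hg, twistedCosetPoly, cosetPoly_congr (cyclotomicCoset_sq_mul_mul hqM (ρ i.succ))]
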